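/- For $d\in\mathbb N$ let $\mathcal C\subset\mathbb Z^d$ be finite, let $\mathcal T_m>0$ ($m\in\mathcal C$) be temperatures, and let $k,j\in\mathcal C$ be neighbours, $|k-j|_{\ell^1}=1$. Write $u=(u_m)_{m\in\mathcal C}\in\mathbb C^{\mathcal C}$, $u_m=p_m+iq_m$. For an interaction potential $V(q_k,q_j)$ let $$\mathcal J_{kj}=p_k\,\partial_{q_k}V(q_k,q_j)-p_j\,\partial_{q_j}V(q_k,q_j),\qquad \mathcal J^{res}_{kj}(u)=\frac1{2\pi}\int_0^{2\pi}\mathcal J_{kj}(e^{i\theta}u)\,d\theta$$ be the energy flow and the resonant energy flow, let $$\mu^0=\prod_{m\in\mathcal C}\frac{1}{2\pi\mathcal T_m}e^{-|u_m|^2/(2\mathcal T_m)}\,du$$ be the Gaussian stationary measure of the Ornstein--Uhlenbeck process $\dot u_m=-\frac{u_m}{2}+\sqrt{\mathcal T_m}\,\dot{\boldsymbol\beta}_m$ ($\boldsymbol\beta_m$ independent standard complex Brownian motions), and let $$A^{kj}=\sum_{l\in\{k,j\}}\Big(\frac{\mathcal T_l}{2}(\partial_{p_l}^2+\partial_{q_l}^2)-\frac12(p_l\partial_{p_l}+q_l\partial_{q_l})\Big).$$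 Let $\eta_{kj}$ be the solution of $A^{kj}\eta_{kj}=\mathcal J^{res}_{kj}$ among the functions of $(u_k,u_j)$ that belong to $W^2_{p,loc}$ for every $1<p<\infty$, have at most polynomial growth at infinity and satisfy $\langle\mu^0,\eta_{kj}\rangle=0$. The conductivity is $$\kappa(\mathcal T_k,\mathcal T_j)=-\frac{\langle\mu^0,\mathcal J^{res}_{kj}\,\eta_{kj}\rangle}{\mathcal T_k\mathcal T_j}.$$ For the quartic interaction $V(q_k,q_j)=(q_k-q_j)^4$ the conductivity is well defined (a solution $\eta_{kj}$ exists, the integral $\langle\mu^0,\mathcal J^{res}_{kj}\eta_{kj}\rangle$ converges, and its value is the same for every such solution), and there is a constant $C>0$, independent of the temperatures and of $d$, $\mathcal C$, $k$, $j$, such that $$\kappa(\mathcal T_k,\mathcal T_j)=C(\mathcal T_k+\mathcal T_j)^2.$$ -/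

import Mathlib

open MeasureTheory
open scoped ENNReal ContDiff

noncomputable section

namespace OscillatorChain

section Phase

variable {ι : Type*} [Fintype ι] [DecidableEq ι]

/-- Poisson-bracket energy flow `p_k ∂_{q_k} V(q_k, q_j) - p_j ∂_{q_j} V(q_k, q_j)` from the `k`-th
oscillator to the `j`-th one, in the complex variables `u_l = p_l + i q_l`. -/
def energyFlow (V : ℝ → ℝ → ℝ) (k j : ι) (u : ι → ℂ) : ℝ :=
  (u k).re * deriv (fun x : ℝ => V x (u j).im) (u k).im
    - (u j).re * deriv (fun y : ℝ => V (u k).im y) (u j).im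

/-- Resonant averaging `⟨f⟩_R(u) = (2π)⁻¹ ∫₀^{2π} f(e^{iθ} u) dθ`. -/
def resonantAverage (f : (ι → ℂ) → ℝ) (u : ι → ℂ) : ℝ :=
  (2 * Real.pi)⁻¹ *
    ∫ θ in (0 : ℝ)..(2 * Real.pi), f (fun m => Complex.exp (θ * Complex.I) * u m)

/-- The resonant energy flow. -/
def resonantFlow (V : ℝ → ℝ → ℝ) (k j : ι) : (ι → ℂ) → ℝ :=
  resonantAverage (energyFlow V k j)

/-- The stationary Gaussian measure of the Ornstein-Uhlenbeck process
`du_m = -(u_m / 2) dτ + √(T_m) dβ_m`, `m ∈ ι`, with independent standard complex Brownian motions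
`β_m = β_m¹ + i β_m²`; its density is `exp (-∑ |u_m|² / (2 T_m)) / ((2π)^|ι| ∏ T_m)`. -/
def gaussianMeasure (T : ι → ℝ) : Measure (ι → ℂ) :=
  (volume : Measure (ι → ℂ)).withDensity fun u =>
    ENNReal.ofReal (Real.exp (-∑ m, ‖u m‖ ^ 2 / (2 * T m)) /
      ((2 * Real.pi) ^ Fintype.card ι * ∏ m, T m))

/-- The unit vector of the real coordinate `p_l` (for `c = (l, 0)`) or `q_l` (for `c = (l, 1)`). -/
def coordVec (c : ι × Fin 2) : ι → ℂ :=
  Pi.single c.1 (![(1 : ℂ), Complex.I] c.2)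

/-- `g` is the weak (distributional) derivative of `f` in the direction `e`. -/
def IsWeakDeriv (e : ι → ℂ) (f g : (ι → ℂ) → ℝ) : Prop :=
  LocallyIntegrable f volume ∧ LocallyIntegrable g volume ∧
    ∀ φ : (ι → ℂ) → ℝ, ContDiff ℝ ∞ φ → HasCompactSupport φ →
      ∫ u, f u * fderiv ℝ φ u e = -∫ u, g u * φ u

/-- `G` and `H` are the weak first and second partial derivatives of `f` with respect to the real
coordinates `p_l, q_l`. -/
def IsWeakJet (f : (ι → ℂ) → ℝ) (G : ι × Fin 2 → (ι → ℂ) → ℝ)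
    (H : ι × Fin 2 → ι × Fin 2 → (ι → ℂ) → ℝ) : Prop :=
  (∀ c, IsWeakDeriv (coordVec c) f (G c)) ∧
    ∀ c c', IsWeakDeriv (coordVec c') (G c) (H c c')

/-- `f ∈ L^p_loc`. -/
def MemLpLoc (p : ℝ≥0∞) (f : (ι → ℂ) → ℝ) : Prop :=
  ∀ K : Set (ι → ℂ), IsCompact K → MemLp f p (volume.restrict K)

/-- `f` belongs to the local Sobolev class `W^2_{p,loc}`. -/
def MemW2Loc (p : ℝ≥0∞) (f : (ι → ℂ) → ℝ) : Prop :=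
  ∃ G H, IsWeakJet f G H ∧ MemLpLoc p f ∧ (∀ c, MemLpLoc p (G c)) ∧
    ∀ c c', MemLpLoc p (H c c')

/-- `f` has at most polynomial growth at infinity. -/
def PolyGrowth (f : (ι → ℂ) → ℝ) : Prop :=
  ∃ (c : ℝ) (n : ℕ), ∀ u, |f u| ≤ c * (1 + ‖u‖) ^ n

/-- The contribution of the site `l` to the Ornstein-Uhlenbeck generator,
`2 T_l ∂²_{u_l ū_l} - (u_l / 2) · ∇_l = (T_l / 2) (∂²_{p_l} + ∂²_{q_l}) - (p_l ∂_{p_l} + q_l ∂_{q_l}) / 2`,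
applied to a function with first derivatives `G` and second derivatives `H`. -/
def ouSite (T : ι → ℝ) (l : ι) (G : ι × Fin 2 → (ι → ℂ) → ℝ)
    (H : ι × Fin 2 → ι × Fin 2 → (ι → ℂ) → ℝ) (u : ι → ℂ) : ℝ :=
  T l / 2 * (H (l, 0) (l, 0) u + H (l, 1) (l, 1) u)
    - ((u l).re * G (l, 0) u + (u l).im * G (l, 1) u) / 2

/-- `η` is a solution of the Poisson equation `A^{kj} η = ξ` for the generator `A^{kj}` of the
Ornstein-Uhlenbeck process of the sites `k, j` (for `k ≠ j`), in the class of functions of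
`u_k, u_j` that belong to `W^2_{p,loc}` for each `1 < p < ∞`, have at most polynomial growth at
infinity and have zero mean with respect to the stationary Gaussian measure. -/
structure IsPoissonSolution (T : ι → ℝ) (k j : ι) (ξ η : (ι → ℂ) → ℝ) : Prop where
  sobolev : ∀ p : ℝ≥0∞, 1 < p → p < ⊤ → MemW2Loc p η
  growth : PolyGrowth η
  mean_zero : ∫ u, η u ∂(gaussianMeasure T) = 0
  support : DependsOn η ({k, j} : Set ι)
  equation : ∃ G H, IsWeakJet η G H ∧
    ∀ᵐ u ∂(volume : Measure (ι → ℂ)), ouSite T k G H u + ouSite T j G H u = ξ u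

end Phase

/-- `κ` is the conductivity for the interaction potential `V`: for every finite set `S` of sites of
a lattice `ℤ^d`, all positive temperatures on `S` and all neighbouring sites `k, j` of `S` (at
`l¹`-distance one), the equation `A^{kj} η = 𝒥^res_{kj}` has a solution, and every solution `η`
yields `κ(T_k, T_j) = -⟨μ⁰, 𝒥^res_{kj} η⟩ / (T_k T_j)`, where the pairing is a convergent integral.
The existence clause makes `κ` unique on pairs of positive temperatures. -/
def IsConductivity (V κ : ℝ → ℝ → ℝ) : Prop :=
  ∀ (d : ℕ) (S : Finset (Fin d → ℤ)) (T : S → ℝ), (∀ m, 0 < T m) →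
    ∀ k j : S, ∑ i, |k.1 i - j.1 i| = 1 →
      (∃ η, IsPoissonSolution T k j (resonantFlow V k j) η) ∧
      ∀ η, IsPoissonSolution T k j (resonantFlow V k j) η →
        Integrable (fun u => resonantFlow V k j u * η u) (gaussianMeasure T) ∧
        κ (T k) (T j) =
          -(∫ u, resonantFlow V k j u * η u ∂(gaussianMeasure T)) / (T k * T j)

/-- The quartic interaction potential. -/
def quarticPotential (x y : ℝ) : ℝ := (x - y) ^ 4

end OscillatorChain

end

/-! For the quartic potential the resonant flow is a polynomial, $\mathcal
J=3|u_k-u_j|^2\,\mathrm{Im}(u_k\bar u_j)$. The operator $A=A^{kj}$ maps polynomials to polynomials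
without raising the degree, and acts on the top homogeneous part of degree $n$ in $u_k,u_j$ as
$-n/2$. So the Poisson equation has an explicit polynomial solution $\eta_0$ (`solutionPoly`), whose
mean vanishes because $\eta_0$ is itself $A$ of a polynomial.

Uniqueness of the solution is never proved. Instead $A$ is symmetric in $L^2(\mu^0)$ between a weak
solution $\eta$ of polynomial growth and a polynomial (`integral_mul_ouPairPoly`), whence
$\langle\mathcal J\eta\rangle=\langle
A\eta_0\,\eta\rangle=\langle\eta_0\,A\eta\rangle=\langle\eta_0\mathcal J\rangle$, and every solution
gives the same number as $\eta_0$. No growth of the weak derivatives of $\eta$ is known, so symmetry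
is proved with compactly supported test functions and then a cutoff is removed.

The Gaussian moment $\langle\mathcal J\eta_0\rangle$ is found without computing moments. Symmetry
against the constant $1$ gives $\langle Ag\rangle=0$ for every polynomial $g$, and an explicit $g$
(`pairingPotential`) satisfies $Ag=\mathcal J\eta_0+360\,T_kT_j(T_k+T_j)^2$. Hence $C=360$. -/

noncomputable section

namespace OscillatorChain

open MvPolynomial Filter Topology

/-! ### Polynomials in the real coordinates as functions on phase space. -/

section Polynomials

variable {ι : Type*}

/-- The real coordinate `p_l` (for `c = (l, 0)`) or `q_l` (for `c = (l, 1)`). -/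
def coord (c : ι × Fin 2) : (ι → ℂ) →L[ℝ] ℝ :=
  (![Complex.reCLM, Complex.imCLM] c.2).comp (ContinuousLinearMap.proj c.1)

@[simp] lemma coord_zero (l : ι) (u : ι → ℂ) : coord (l, 0) u = (u l).re := rfl

@[simp] lemma coord_one (l : ι) (u : ι → ℂ) : coord (l, 1) u = (u l).im := rfl

lemma coord_coordVec [DecidableEq ι] (c c' : ι × Fin 2) :
    coord c (coordVec c') = if c = c' then 1 else 0 := by
  obtain ⟨l, i⟩ := c
  obtain ⟨m, i'⟩ := c'
  by_cases h : l = m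
  · subst h
    fin_cases i <;> fin_cases i' <;> simp [coordVec]
  · have : coordVec (m, i') l = 0 := by simp [coordVec, h]
    fin_cases i <;> simp [this, h]

/-- The function on the phase space defined by a polynomial in the real coordinates. -/
def polyFun (P : MvPolynomial (ι × Fin 2) ℝ) (u : ι → ℂ) : ℝ :=
  eval (fun c => coord c u) P

@[simp] lemma polyFun_C (a : ℝ) (u : ι → ℂ) : polyFun (C a) u = a := by simp [polyFun]

@[simp] lemma polyFun_X (c : ι × Fin 2) (u : ι → ℂ) : polyFun (X c) u = coord c u := by
  simp [polyFun]

@[simp] lemma polyFun_add (P Q : MvPolynomial (ι × Fin 2) ℝ) (u : ι → ℂ) :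
    polyFun (P + Q) u = polyFun P u + polyFun Q u := by simp [polyFun]

@[simp] lemma polyFun_sub (P Q : MvPolynomial (ι × Fin 2) ℝ) (u : ι → ℂ) :
    polyFun (P - Q) u = polyFun P u - polyFun Q u := by simp [polyFun]

@[simp] lemma polyFun_neg (P : MvPolynomial (ι × Fin 2) ℝ) (u : ι → ℂ) :
    polyFun (-P) u = -polyFun P u := by simp [polyFun]

@[simp] lemma polyFun_mul (P Q : MvPolynomial (ι × Fin 2) ℝ) (u : ι → ℂ) :
    polyFun (P * Q) u = polyFun P u * polyFun Q u := by simp [polyFun]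

@[simp] lemma polyFun_pow (P : MvPolynomial (ι × Fin 2) ℝ) (n : ℕ) (u : ι → ℂ) :
    polyFun (P ^ n) u = polyFun P u ^ n := by simp [polyFun]

@[simp] lemma polyFun_zero (u : ι → ℂ) : polyFun 0 u = 0 := by simp [polyFun]

@[simp] lemma polyFun_one (u : ι → ℂ) : polyFun 1 u = 1 := by simp [polyFun]

variable [Fintype ι]

lemma abs_coord_le (c : ι × Fin 2) (u : ι → ℂ) : |coord c u| ≤ ‖u‖ := by
  obtain ⟨l, i⟩ := c
  refine le_trans ?_ (norm_le_pi_norm u l)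
  fin_cases i
  · exact Complex.abs_re_le_norm _
  · exact Complex.abs_im_le_norm _

lemma contDiff_polyFun (P : MvPolynomial (ι × Fin 2) ℝ) : ContDiff ℝ ∞ (polyFun P) := by
  induction P using MvPolynomial.induction_on with
  | C a => simpa only [funext (polyFun_C a)] using contDiff_const
  | add P Q hP hQ => simpa [funext (polyFun_add P Q)] using hP.add hQ
  | mul_X P c hP => simpa [funext (polyFun_mul P (X c))] using hP.mul (coord c).contDiff

lemma continuous_polyFun (P : MvPolynomial (ι × Fin 2) ℝ) : Continuous (polyFun P) :=
  (contDiff_polyFun P).continuous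

lemma differentiable_polyFun (P : MvPolynomial (ι × Fin 2) ℝ) : Differentiable ℝ (polyFun P) :=
  (contDiff_polyFun P).differentiable (by simp)

lemma fderiv_polyFun [DecidableEq ι] (P : MvPolynomial (ι × Fin 2) ℝ) (c : ι × Fin 2)
    (u : ι → ℂ) : fderiv ℝ (polyFun P) u (coordVec c) = polyFun (pderiv c P) u := by
  induction P using MvPolynomial.induction_on with
  | C a =>
    have : polyFun (C a : MvPolynomial (ι × Fin 2) ℝ) = fun _ => a := funext (polyFun_C a)
    simp [this]
  | add P Q hP hQ =>
    have : polyFun (P + Q) = polyFun P + polyFun Q := funext (polyFun_add P Q)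
    rw [this, fderiv_add (differentiable_polyFun P u) (differentiable_polyFun Q u)]
    simp [hP, hQ]
  | mul_X P c' hP =>
    have : polyFun (P * X c') = polyFun P * (coord c' : (ι → ℂ) → ℝ) := by ext; simp
    rw [this, fderiv_mul (differentiable_polyFun P u) (coord c').differentiableAt]
    simp only [ContinuousLinearMap.fderiv, pderiv_mul, pderiv_X, add_apply,
      smul_apply, coord_coordVec, hP, smul_eq_mul, polyFun_add, polyFun_mul,
      polyFun_X, Pi.single_apply]
    split_ifs <;> simp <;> ring

lemma PolyGrowth.mul {f g : (ι → ℂ) → ℝ} (hf : PolyGrowth f) (hg : PolyGrowth g) :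
    PolyGrowth (fun u => f u * g u) := by
  obtain ⟨a, n, hf⟩ := hf
  obtain ⟨b, m, hg⟩ := hg
  refine ⟨a * b, n + m, fun u => ?_⟩
  rw [abs_mul, pow_add]
  calc |f u| * |g u| ≤ (a * (1 + ‖u‖) ^ n) * (b * (1 + ‖u‖) ^ m) :=
        mul_le_mul (hf u) (hg u) (abs_nonneg _) ((abs_nonneg _).trans (hf u))
    _ = _ := by ring

lemma PolyGrowth.add {f g : (ι → ℂ) → ℝ} (hf : PolyGrowth f) (hg : PolyGrowth g) :
    PolyGrowth (fun u => f u + g u) := by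
  obtain ⟨a, n, hf⟩ := hf
  obtain ⟨b, m, hg⟩ := hg
  refine ⟨|a| + |b|, n + m, fun u => ?_⟩
  have h1 : 1 ≤ 1 + ‖u‖ := by linarith [norm_nonneg u]
  have hn : (1 + ‖u‖) ^ n ≤ (1 + ‖u‖) ^ (n + m) := pow_le_pow_right₀ h1 (by omega)
  have hm : (1 + ‖u‖) ^ m ≤ (1 + ‖u‖) ^ (n + m) := pow_le_pow_right₀ h1 (by omega)
  calc |f u + g u| ≤ |f u| + |g u| := abs_add_le _ _
    _ ≤ a * (1 + ‖u‖) ^ n + b * (1 + ‖u‖) ^ m := add_le_add (hf u) (hg u)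
    _ ≤ |a| * (1 + ‖u‖) ^ (n + m) + |b| * (1 + ‖u‖) ^ (n + m) := by
        gcongr <;> exact le_abs_self _
    _ = _ := by ring

lemma polyGrowth_const (a : ℝ) : PolyGrowth (fun _ : ι → ℂ => a) :=
  ⟨|a|, 0, fun u => by simp⟩

lemma polyGrowth_polyFun (P : MvPolynomial (ι × Fin 2) ℝ) : PolyGrowth (polyFun P) := by
  induction P using MvPolynomial.induction_on with
  | C a => simpa only [funext (polyFun_C a)] using polyGrowth_const a
  | add P Q hP hQ => simpa [funext (polyFun_add P Q)] using hP.add hQ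
  | mul_X P c hP =>
    have hc : PolyGrowth (fun u : ι → ℂ => coord c u) :=
      ⟨1, 1, fun u => by linarith [abs_coord_le c u]⟩
    simpa [funext (polyFun_mul P (X c))] using hP.mul hc

end Polynomials

/-! ### The Gaussian density and integrability of functions of polynomial growth. -/

section Gaussian

variable {ι : Type*} [Fintype ι]

/-- The density of the stationary Gaussian measure. -/
def gaussianDensity (T : ι → ℝ) (u : ι → ℂ) : ℝ :=
  Real.exp (-∑ m, ‖u m‖ ^ 2 / (2 * T m)) / ((2 * Real.pi) ^ Fintype.card ι * ∏ m, T m)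

/-- The exponent of the Gaussian density as a polynomial. -/
def gaussianExponent (T : ι → ℝ) : MvPolynomial (ι × Fin 2) ℝ :=
  ∑ m, C (-(2 * T m)⁻¹) * (X (m, 0) ^ 2 + X (m, 1) ^ 2)

lemma gaussianDensity_eq (T : ι → ℝ) (u : ι → ℂ) : gaussianDensity T u =
    ((2 * Real.pi) ^ Fintype.card ι * ∏ m, T m)⁻¹ *
      Real.exp (polyFun (gaussianExponent T) u) := by
  have : polyFun (gaussianExponent T) u = -∑ m, ‖u m‖ ^ 2 / (2 * T m) := by
    rw [gaussianExponent, polyFun, map_sum, ← Finset.sum_neg_distrib]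
    refine Finset.sum_congr rfl fun m _ => ?_
    simp only [← Complex.normSq_eq_norm_sq, Complex.normSq_apply, map_mul, map_add, map_pow,
      eval_X, eval_C, coord_zero, coord_one]
    ring
  rw [gaussianDensity, this]
  ring

lemma gaussianDensity_nonneg {T : ι → ℝ} (hT : ∀ m, 0 < T m) (u : ι → ℂ) :
    0 ≤ gaussianDensity T u := by
  have : 0 ≤ ∏ m, T m := Finset.prod_nonneg fun m _ => (hT m).le
  unfold gaussianDensity
  positivity

lemma contDiff_gaussianDensity (T : ι → ℝ) : ContDiff ℝ ∞ (gaussianDensity T) := by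
  rw [funext (gaussianDensity_eq T)]
  exact contDiff_const.mul (contDiff_polyFun _).exp

lemma pderiv_gaussianExponent [DecidableEq ι] (T : ι → ℝ) (c : ι × Fin 2) :
    pderiv c (gaussianExponent T) = C (-(T c.1)⁻¹) * X c := by
  rw [gaussianExponent, map_sum, Finset.sum_eq_single c.1]
  · obtain ⟨l, i⟩ := c
    have h : (C (-(T l)⁻¹) : MvPolynomial (ι × Fin 2) ℝ) = C (-(2 * T l)⁻¹) * 2 := by
      rw [show (2 : MvPolynomial (ι × Fin 2) ℝ) = C 2 from (map_ofNat C 2).symm, ← C_mul]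
      congr 1
      rw [mul_inv]
      ring
    fin_cases i <;> simp [h, pderiv_X] <;> ring
  · intro m _ hm
    obtain ⟨l, i⟩ := c
    have hm : m ≠ l := hm
    simp [pderiv_X, hm]
  · simp

lemma fderiv_gaussianDensity [DecidableEq ι] (T : ι → ℝ) (c : ι × Fin 2) (u : ι → ℂ) :
    fderiv ℝ (gaussianDensity T) u (coordVec c) =
      -(T c.1)⁻¹ * coord c u * gaussianDensity T u := by
  rw [gaussianDensity_eq, funext (gaussianDensity_eq T)]
  have hd := differentiable_polyFun (gaussianExponent T) u
  rw [fderiv_const_mul hd.exp, fderiv_exp hd]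
  simp [fderiv_polyFun, pderiv_gaussianExponent]
  ring

lemma integral_gaussianMeasure {T : ι → ℝ} (hT : ∀ m, 0 < T m) (f : (ι → ℂ) → ℝ) :
    ∫ u, f u ∂(gaussianMeasure T) = ∫ u, f u * gaussianDensity T u := by
  have hc := (contDiff_gaussianDensity T).continuous
  have := integral_withDensity_eq_integral_toReal_smul (μ := (volume : Measure (ι → ℂ)))
    (f := fun u => ENNReal.ofReal (gaussianDensity T u)) (by fun_prop) (by simp) f
  refine this.trans (integral_congr_ae (Eventually.of_forall fun u => ?_))
  simp [ENNReal.toReal_ofReal (gaussianDensity_nonneg hT u), mul_comm]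

lemma integrable_gaussianMeasure {T : ι → ℝ} (hT : ∀ m, 0 < T m) {f : (ι → ℂ) → ℝ}
    (hf : Integrable (fun u => f u * gaussianDensity T u)) :
    Integrable f (gaussianMeasure T) := by
  have hc := (contDiff_gaussianDensity T).continuous
  refine (integrable_withDensity_iff (f := fun u => ENNReal.ofReal (gaussianDensity T u))
    (by fun_prop) (by simp)).2 (hf.congr (Eventually.of_forall fun u => ?_))
  simp [ENNReal.toReal_ofReal (gaussianDensity_nonneg hT u)]

lemma gaussianDensity_eq_prod (T : ι → ℝ) (u : ι → ℂ) : gaussianDensity T u =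
    ∏ m, (2 * Real.pi * T m)⁻¹ * Real.exp (-(2 * T m)⁻¹ * ‖u m‖ ^ 2) := by
  rw [gaussianDensity, Finset.prod_mul_distrib, ← Real.exp_sum, Finset.prod_inv_distrib,
    Finset.prod_mul_distrib, Finset.prod_const, Finset.card_univ, ← Finset.sum_neg_distrib,
    div_eq_inv_mul]
  congr 2
  refine Finset.sum_congr rfl fun m _ => ?_
  ring

lemma integral_gaussianDensity {T : ι → ℝ} (hT : ∀ m, 0 < T m) :
    ∫ u, gaussianDensity T u = 1 := by
  simp_rw [gaussianDensity_eq_prod]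
  rw [integral_fintype_prod_volume_eq_prod
    (fun m (z : ℂ) => (2 * Real.pi * T m)⁻¹ * Real.exp (-(2 * T m)⁻¹ * ‖z‖ ^ 2))]
  refine Finset.prod_eq_one fun m _ => ?_
  have h := hT m
  rw [integral_const_mul, GaussianFourier.integral_rexp_neg_mul_sq_norm (by positivity)]
  simp only [Complex.finrank_real_complex]
  norm_num
  field_simp

lemma integrable_exp_neg_mul_sq_norm {b : ℝ} (hb : 0 < b) :
    Integrable (fun z : ℂ => Real.exp (-b * ‖z‖ ^ 2)) := by
  -- The Bochner integral of a non-integrable function is $0$, so a nonzero value proves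
  -- integrability.
  refine Integrable.of_integral_ne_zero ?_
  rw [GaussianFourier.integral_rexp_neg_mul_sq_norm hb]
  positivity

lemma integrable_pow_mul_exp_neg_mul_sq_norm {b : ℝ} (hb : 0 < b) (n : ℕ) :
    Integrable (fun z : ℂ => (1 + ‖z‖) ^ n * Real.exp (-b * ‖z‖ ^ 2)) := by
  refine ((integrable_exp_neg_mul_sq_norm (half_pos hb)).const_mul
    (n.factorial * Real.exp (1 + (2 * b)⁻¹))).mono' (by fun_prop)
    (Eventually.of_forall fun z => ?_)
  have hz := norm_nonneg z
  have h1 : (1 + ‖z‖) ^ n ≤ n.factorial * Real.exp (1 + ‖z‖) := by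
    have := Real.pow_div_factorial_le_exp (1 + ‖z‖) (by positivity) n
    rwa [div_le_iff₀' (by positivity)] at this
  -- Completing the square: the linear exponent that dominates the power costs only half of the
  -- Gaussian decay.
  have h2 : ‖z‖ ≤ (2 * b)⁻¹ + b / 2 * ‖z‖ ^ 2 := by
    have : (2 * b)⁻¹ + b / 2 * ‖z‖ ^ 2 - ‖z‖ = (2 * b)⁻¹ * (b * ‖z‖ - 1) ^ 2 := by
      field_simp
      ring
    have h3 : 0 ≤ (2 * b)⁻¹ * (b * ‖z‖ - 1) ^ 2 := by positivity
    linarith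
  rw [Real.norm_of_nonneg (by positivity)]
  calc (1 + ‖z‖) ^ n * Real.exp (-b * ‖z‖ ^ 2)
      ≤ n.factorial * Real.exp (1 + ‖z‖) * Real.exp (-b * ‖z‖ ^ 2) := by gcongr
    _ = n.factorial * Real.exp (1 + ‖z‖ + -b * ‖z‖ ^ 2) := by
        rw [Real.exp_add (1 + ‖z‖)]; ring
    _ ≤ n.factorial * Real.exp (1 + (2 * b)⁻¹ + -(b / 2) * ‖z‖ ^ 2) := by
        refine mul_le_mul_of_nonneg_left (Real.exp_le_exp.2 ?_) (by positivity)
        linarith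
    _ = _ := by rw [Real.exp_add (1 + (2 * b)⁻¹)]; ring

lemma integrable_mul_gaussianDensity {T : ι → ℝ} (hT : ∀ m, 0 < T m) {f : (ι → ℂ) → ℝ}
    (hf : AEStronglyMeasurable f volume) (hg : PolyGrowth f) :
    Integrable (fun u => f u * gaussianDensity T u) := by
  obtain ⟨a, n, hg⟩ := hg
  have hc := (contDiff_gaussianDensity T).continuous
  have hI : Integrable (fun u : ι → ℂ => ∏ m, (2 * Real.pi * T m)⁻¹ *
      ((1 + ‖u m‖) ^ n * Real.exp (-(2 * T m)⁻¹ * ‖u m‖ ^ 2))) := by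
    refine Integrable.fintype_prod (f := fun m (z : ℂ) => (2 * Real.pi * T m)⁻¹ *
      ((1 + ‖z‖) ^ n * Real.exp (-(2 * T m)⁻¹ * ‖z‖ ^ 2))) fun m => ?_
    have := hT m
    exact (integrable_pow_mul_exp_neg_mul_sq_norm (by positivity) n).const_mul _
  refine (hI.const_mul |a|).mono' (hf.mul hc.aestronglyMeasurable)
    (Eventually.of_forall fun u => ?_)
  -- The norm is the supremum over sites, so this bound splits the integral into one-site integrals.
  have hprod : 1 + ‖u‖ ≤ ∏ m, (1 + ‖u m‖) := by
    have h1 : ∀ m, 1 ≤ 1 + ‖u m‖ := fun m => by linarith [norm_nonneg (u m)]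
    have h2 : ‖u‖ ≤ ∏ m, (1 + ‖u m‖) - 1 := by
      have h3 : 1 ≤ ∏ m, (1 + ‖u m‖) := Finset.one_le_prod fun m _ => h1 m
      refine (pi_norm_le_iff_of_nonneg (by linarith)).2 fun m => ?_
      have : 1 + ‖u m‖ ≤ ∏ m, (1 + ‖u m‖) := by
        classical
        rw [← Finset.mul_prod_erase _ _ (Finset.mem_univ m)]
        exact le_mul_of_one_le_right (by positivity) (Finset.one_le_prod fun m _ => h1 m)
      linarith
    linarith
  rw [norm_mul, Real.norm_of_nonneg (gaussianDensity_nonneg hT u), Real.norm_eq_abs]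
  calc |f u| * gaussianDensity T u ≤ |a| * (∏ m, (1 + ‖u m‖)) ^ n * gaussianDensity T u := by
        refine mul_le_mul_of_nonneg_right ((hg u).trans ?_) (gaussianDensity_nonneg hT u)
        gcongr
        exact le_abs_self a
    _ = _ := by
        rw [gaussianDensity_eq_prod, ← Finset.prod_pow, mul_assoc, ← Finset.prod_mul_distrib]
        congr 1
        refine Finset.prod_congr rfl fun m _ => ?_
        ring

end Gaussian

/-! ### Polynomials have all the required weak derivatives. -/

section WeakDerivatives

variable {ι : Type*} [Fintype ι]

lemma isWeakDeriv_fderiv {f : (ι → ℂ) → ℝ} (hf : ContDiff ℝ ∞ f) (e : ι → ℂ) :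
    IsWeakDeriv e f (fun u => fderiv ℝ f u e) := by
  have hf' : Continuous (fun u => fderiv ℝ f u e) :=
    (hf.continuous_fderiv (by simp)).clm_apply continuous_const
  refine ⟨hf.continuous.locallyIntegrable, hf'.locallyIntegrable, fun φ hφ hs => ?_⟩
  have hφ' : Continuous (fun u => fderiv ℝ φ u e) :=
    (hφ.continuous_fderiv (by simp)).clm_apply continuous_const
  refine integral_mul_fderiv_eq_neg_fderiv_mul_of_integrable ?_ ?_ ?_
    (fun u _ => hf.differentiable (by simp) u) (fun u _ => hφ.differentiable (by simp) u)
  · exact (hf'.mul hφ.continuous).integrable_of_hasCompactSupport hs.mul_left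
  · exact (hf.continuous.mul hφ').integrable_of_hasCompactSupport
      (hs.fderiv_apply (𝕜 := ℝ) e).mul_left
  · exact (hf.continuous.mul hφ.continuous).integrable_of_hasCompactSupport hs.mul_left

lemma isWeakJet_polyFun [DecidableEq ι] (P : MvPolynomial (ι × Fin 2) ℝ) :
    IsWeakJet (polyFun P) (fun c => polyFun (pderiv c P))
      (fun c c' => polyFun (pderiv c' (pderiv c P))) := by
  have h (Q : MvPolynomial (ι × Fin 2) ℝ) (c : ι × Fin 2) :
      IsWeakDeriv (coordVec c) (polyFun Q) (polyFun (pderiv c Q)) := by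
    simpa only [fderiv_polyFun] using isWeakDeriv_fderiv (contDiff_polyFun Q) (coordVec c)
  exact ⟨fun c => h P c, fun c c' => h _ c'⟩

lemma memLpLoc_of_continuous {f : (ι → ℂ) → ℝ} (hf : Continuous f) (p : ℝ≥0∞) :
    MemLpLoc p f := by
  intro K hK
  obtain ⟨M, hM⟩ := hK.exists_bound_of_continuousOn hf.continuousOn
  have : IsFiniteMeasure (volume.restrict K) := ⟨by simpa using hK.measure_lt_top⟩
  exact MemLp.of_bound hf.aestronglyMeasurable M
    (ae_restrict_of_forall_mem hK.measurableSet hM)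

lemma memW2Loc_polyFun [DecidableEq ι] (P : MvPolynomial (ι × Fin 2) ℝ) (p : ℝ≥0∞) :
    MemW2Loc p (polyFun P) :=
  ⟨_, _, isWeakJet_polyFun P, memLpLoc_of_continuous (continuous_polyFun P) p,
    fun _ => memLpLoc_of_continuous (continuous_polyFun _) p,
    fun _ _ => memLpLoc_of_continuous (continuous_polyFun _) p⟩

end WeakDerivatives

/-! ### Symmetry of the generator, by integration by parts and cutoffs. -/

section Symmetry

variable {ι : Type*} [Fintype ι]

lemma contDiff_fderiv_apply {f : (ι → ℂ) → ℝ} (hf : ContDiff ℝ ∞ f) (e : ι → ℂ) :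
    ContDiff ℝ ∞ (fun u => fderiv ℝ f u e) :=
  (hf.fderiv_right (m := ∞) (by simp)).clm_apply contDiff_const

lemma integrable_mul_of_hasCompactSupport {f g : (ι → ℂ) → ℝ} (hf : LocallyIntegrable f volume)
    (hg : Continuous g) (hs : HasCompactSupport g) : Integrable (fun u => f u * g u) := by
  simpa [mul_comm] using hf.integrable_smul_left_of_hasCompactSupport hg hs

/-- The one-dimensional Ornstein-Uhlenbeck operator in a coordinate is symmetric with respect to the
Gaussian measure, when tested against smooth compactly supported functions. -/
lemma integral_ou_mul_test [DecidableEq ι] {T : ι → ℝ} (hT : ∀ m, 0 < T m) (c : ι × Fin 2)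
    {f G H : (ι → ℂ) → ℝ} (hG : IsWeakDeriv (coordVec c) f G)
    (hH : IsWeakDeriv (coordVec c) G H) {g : (ι → ℂ) → ℝ} (hg : ContDiff ℝ ∞ g)
    (hs : HasCompactSupport g) :
    Integrable (fun u => (T c.1 / 2 * H u - coord c u * G u / 2) * (gaussianDensity T u * g u)) ∧
    ∫ u, (T c.1 / 2 * H u - coord c u * G u / 2) * (gaussianDensity T u * g u) =
      ∫ u, f u * gaussianDensity T u *
        (T c.1 / 2 * fderiv ℝ (fun v => fderiv ℝ g v (coordVec c)) u (coordVec c)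
          - coord c u / 2 * fderiv ℝ g u (coordVec c)) := by
  have hρ := contDiff_gaussianDensity T
  have hx : ContDiff ℝ ∞ (coord c : (ι → ℂ) → ℝ) := (coord c).contDiff
  have hTc := (hT c.1).ne'
  have hdg := contDiff_fderiv_apply hg (coordVec c)
  have hsg : HasCompactSupport (fun u => fderiv ℝ g u (coordVec c)) :=
    hs.fderiv_apply (𝕜 := ℝ) _
  have hρg : ContDiff ℝ ∞ (fun u => gaussianDensity T u * g u) := hρ.mul hg
  have hsρg : HasCompactSupport (fun u => gaussianDensity T u * g u) := hs.mul_left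
  -- Differentiating the density produces exactly the drift: $\frac T2\partial^2 f-\frac x2\partial
  -- f=\frac T2\rho^{-1}\partial(\rho\,\partial f)$. Hence one integration by parts for $H$ and one
  -- for $G$ suffice.
  have hd1 (u) : fderiv ℝ (fun u => gaussianDensity T u * g u) u (coordVec c) =
      gaussianDensity T u * fderiv ℝ g u (coordVec c)
        - (T c.1)⁻¹ * (coord c u * (gaussianDensity T u * g u)) := by
    rw [fderiv_fun_mul (hρ.differentiable (by simp) u) (hg.differentiable (by simp) u)]
    simp [fderiv_gaussianDensity]
    ring
  have hd2 (u) : fderiv ℝ (fun u => gaussianDensity T u * fderiv ℝ g u (coordVec c)) u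
        (coordVec c) =
      gaussianDensity T u * fderiv ℝ (fun v => fderiv ℝ g v (coordVec c)) u (coordVec c)
        - (T c.1)⁻¹ * (coord c u * (gaussianDensity T u * fderiv ℝ g u (coordVec c))) := by
    rw [fderiv_fun_mul (hρ.differentiable (by simp) u) (hdg.differentiable (by simp) u)]
    simp [fderiv_gaussianDensity]
    ring
  have e1 := hH.2.2 _ hρg hsρg
  have e2 := hG.2.2 (fun u => gaussianDensity T u * fderiv ℝ g u (coordVec c)) (hρ.mul hdg)
    hsg.mul_left
  have i1 := integrable_mul_of_hasCompactSupport hH.2.1 hρg.continuous hsρg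
  have i2 : Integrable (fun u => G u * (coord c u * (gaussianDensity T u * g u))) :=
    integrable_mul_of_hasCompactSupport hG.2.1 (hx.mul hρg).continuous hsρg.mul_left
  have i3 : Integrable (fun u => G u * (gaussianDensity T u * fderiv ℝ g u (coordVec c))) :=
    integrable_mul_of_hasCompactSupport hG.2.1 (hρ.mul hdg).continuous hsg.mul_left
  have hsplit : (fun u => (T c.1 / 2 * H u - coord c u * G u / 2) * (gaussianDensity T u * g u)) =
      fun u => T c.1 / 2 * (H u * (gaussianDensity T u * g u))
        - 2⁻¹ * (G u * (coord c u * (gaussianDensity T u * g u))) := by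
    ext u; ring
  rw [hsplit]
  refine ⟨(i1.const_mul _).sub (i2.const_mul _), ?_⟩
  rw [integral_sub (i1.const_mul _) (i2.const_mul _), integral_const_mul, integral_const_mul]
  have e1' : ∫ u, H u * (gaussianDensity T u * g u) =
      (T c.1)⁻¹ * (∫ u, G u * (coord c u * (gaussianDensity T u * g u)))
        - ∫ u, G u * (gaussianDensity T u * fderiv ℝ g u (coordVec c)) := by
    rw [← integral_const_mul, ← integral_sub (i2.const_mul _) i3, ← neg_eq_iff_eq_neg.2 e1,
      ← integral_neg]
    congr 1 with u
    rw [hd1]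
    ring
  have e2' : ∫ u, f u * gaussianDensity T u *
        (T c.1 / 2 * fderiv ℝ (fun v => fderiv ℝ g v (coordVec c)) u (coordVec c)
          - coord c u / 2 * fderiv ℝ g u (coordVec c)) =
      T c.1 / 2 * ∫ u, f u * fderiv ℝ (fun u => gaussianDensity T u *
        fderiv ℝ g u (coordVec c)) u (coordVec c) := by
    rw [← integral_const_mul]
    congr 1 with u
    rw [hd2]
    field_simp
  rw [e2', e2, e1']
  field_simp
  ring

/-- Smooth cutoff functions at scale `n + 1`, with uniformly small derivatives. -/
lemma exists_cutoff (ι : Type*) [Fintype ι] : ∃ χ : ℕ → (ι → ℂ) → ℝ,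
    (∀ n, ContDiff ℝ ∞ (χ n)) ∧ (∀ n, HasCompactSupport (χ n)) ∧ (∀ n u, |χ n u| ≤ 1) ∧
    (∀ u, Tendsto (fun n => χ n u) atTop (𝓝 1)) ∧
    ∀ e : ι → ℂ, ∃ M : ℝ, ∀ n u, |fderiv ℝ (χ n) u e| ≤ M * ((n : ℝ) + 1)⁻¹ ∧
      |fderiv ℝ (fun v => fderiv ℝ (χ n) v e) u e| ≤ M * ((n : ℝ) + 1)⁻¹ := by
  let b : ContDiffBump (0 : ι → ℂ) := ⟨1, 2, one_pos, one_lt_two⟩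
  have hb : ContDiff ℝ ∞ b := b.contDiff
  have hpos (n : ℕ) : (0 : ℝ) < ((n : ℝ) + 1)⁻¹ := by positivity
  have hle (n : ℕ) : ((n : ℝ) + 1)⁻¹ ≤ 1 :=
    inv_le_one_of_one_le₀ (by linarith [n.cast_nonneg (α := ℝ)])
  refine ⟨fun n u => b (((n : ℝ) + 1)⁻¹ • u), fun n => hb.comp (contDiff_const_smul _),
    fun n => b.hasCompactSupport.comp_smul (hpos n).ne', fun n u => ?_, fun u => ?_, fun e => ?_⟩
  · rw [abs_of_nonneg b.nonneg]
    exact b.le_one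
  · have h0 : b 0 = 1 := b.one_of_mem_closedBall (by simp [b])
    have h1 : Tendsto (fun n : ℕ => ((n : ℝ) + 1)⁻¹ • u) atTop (𝓝 0) := by
      simpa using (tendsto_one_div_add_atTop_nhds_zero_nat (𝕜 := ℝ)).smul_const u
    simpa [h0, Function.comp_def] using (b.continuous.tendsto 0).comp h1
  · have hd := contDiff_fderiv_apply hb e
    have hdd := contDiff_fderiv_apply hd e
    have hsd : HasCompactSupport (fun u => fderiv ℝ b u e) :=
      b.hasCompactSupport.fderiv_apply (𝕜 := ℝ) e
    have hsdd : HasCompactSupport (fun u => fderiv ℝ (fun v => fderiv ℝ b v e) u e) :=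
      hsd.fderiv_apply (𝕜 := ℝ) e
    obtain ⟨M₁, hM₁⟩ := hsd.exists_bound_of_continuous hd.continuous
    obtain ⟨M₂, hM₂⟩ := hsdd.exists_bound_of_continuous hdd.continuous
    have d1 (n : ℕ) (u : ι → ℂ) : fderiv ℝ (fun v => b (((n : ℝ) + 1)⁻¹ • v)) u e =
        ((n : ℝ) + 1)⁻¹ * fderiv ℝ b (((n : ℝ) + 1)⁻¹ • u) e := by
      rw [fderiv_comp_smul]; rfl
    have d2 (n : ℕ) (u : ι → ℂ) :
        fderiv ℝ (fun v => fderiv ℝ (fun v => b (((n : ℝ) + 1)⁻¹ • v)) v e) u e =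
        ((n : ℝ) + 1)⁻¹ * (((n : ℝ) + 1)⁻¹ *
          fderiv ℝ (fun v => fderiv ℝ b v e) (((n : ℝ) + 1)⁻¹ • u) e) := by
      -- The second derivative gains a further factor $(n+1)^{-1}\le1$, which the common bound
      -- discards.
      simp_rw [d1]
      have hd' : Differentiable ℝ (fun v => fderiv ℝ b (((n : ℝ) + 1)⁻¹ • v) e) :=
        (hd.comp (contDiff_const_smul _)).differentiable (by simp)
      rw [fderiv_const_mul (hd' u), fderiv_comp_smul (f := fun v => fderiv ℝ b v e)]
      rfl
    refine ⟨max M₁ M₂, fun n u => ?_⟩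
    rw [d1, d2, abs_mul, abs_mul, abs_mul, abs_of_pos (hpos n)]
    have h1 : |fderiv ℝ b (((n : ℝ) + 1)⁻¹ • u) e| ≤ max M₁ M₂ :=
      (hM₁ _).trans (le_max_left _ _)
    have h2 : |fderiv ℝ (fun v => fderiv ℝ b v e) (((n : ℝ) + 1)⁻¹ • u) e| ≤ max M₁ M₂ :=
      (hM₂ _).trans (le_max_right _ _)
    constructor
    · rw [mul_comm]
      exact mul_le_mul_of_nonneg_right h1 (hpos n).le
    · rw [mul_comm (max M₁ M₂)]
      refine mul_le_mul_of_nonneg_left ?_ (hpos n).le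
      exact (mul_le_of_le_one_left (abs_nonneg _) (hle n)).trans h2

lemma tendsto_integral_mul_of_bounded {w : (ι → ℂ) → ℝ} (hw : Integrable w)
    {h : ℕ → (ι → ℂ) → ℝ} (hc : ∀ n, Continuous (h n)) {M a : ℝ} (hM : ∀ n u, |h n u| ≤ M)
    (hl : ∀ u, Tendsto (fun n => h n u) atTop (𝓝 a)) :
    Tendsto (fun n => ∫ u, w u * h n u) atTop (𝓝 (∫ u, w u * a)) := by
  refine tendsto_integral_of_dominated_convergence (fun u => |w u| * M)
    (fun n => hw.aestronglyMeasurable.mul (hc n).aestronglyMeasurable) (hw.abs.mul_const M)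
    (fun n => Eventually.of_forall fun u => ?_)
    (Eventually.of_forall fun u => (hl u).const_mul _)
  rw [norm_mul]
  exact mul_le_mul_of_nonneg_left (hM n u) (abs_nonneg _)

/-- The one-dimensional Ornstein-Uhlenbeck operator in the coordinate `c`, acting on polynomials. -/
def ouPoly [DecidableEq ι] (T : ι → ℝ) (c : ι × Fin 2) (P : MvPolynomial (ι × Fin 2) ℝ) :
    MvPolynomial (ι × Fin 2) ℝ :=
  C (T c.1 / 2) * pderiv c (pderiv c P) - C (1 / 2) * X c * pderiv c P

/-- The generator `A^{kj}` acting on polynomials. -/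
def ouPairPoly [DecidableEq ι] (T : ι → ℝ) (k j : ι) (P : MvPolynomial (ι × Fin 2) ℝ) :
    MvPolynomial (ι × Fin 2) ℝ :=
  ouPoly T (k, 0) P + ouPoly T (k, 1) P + (ouPoly T (j, 0) P + ouPoly T (j, 1) P)

/-- All derivatives have been moved onto $P\chi_n$, so only the growth of $f$ itself matters. The
terms where a derivative falls on $\chi_n$ vanish in the limit by dominated convergence. -/
lemma tendsto_integral_ou_cutoff [DecidableEq ι] {T : ι → ℝ} (hT : ∀ m, 0 < T m)
    {f : (ι → ℂ) → ℝ} (hf : AEStronglyMeasurable f volume) (hfg : PolyGrowth f)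
    (c : ι × Fin 2) (P : MvPolynomial (ι × Fin 2) ℝ) {χ : ℕ → (ι → ℂ) → ℝ}
    (hχ : ∀ n, ContDiff ℝ ∞ (χ n)) (hχ1 : ∀ n u, |χ n u| ≤ 1)
    (hχl : ∀ u, Tendsto (fun n => χ n u) atTop (𝓝 1))
    (hχd : ∀ e : ι → ℂ, ∃ M : ℝ, ∀ n u, |fderiv ℝ (χ n) u e| ≤ M * ((n : ℝ) + 1)⁻¹ ∧
      |fderiv ℝ (fun v => fderiv ℝ (χ n) v e) u e| ≤ M * ((n : ℝ) + 1)⁻¹) :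
    Tendsto (fun n => ∫ u, f u * gaussianDensity T u *
        (T c.1 / 2 * fderiv ℝ (fun v => fderiv ℝ (fun v => polyFun P v * χ n v) v (coordVec c)) u
            (coordVec c)
          - coord c u / 2 * fderiv ℝ (fun v => polyFun P v * χ n v) u (coordVec c)))
      atTop (𝓝 (∫ u, f u * polyFun (ouPoly T c P) u * gaussianDensity T u)) := by
  have hw (Q : MvPolynomial (ι × Fin 2) ℝ) :
      Integrable (fun u => f u * polyFun Q u * gaussianDensity T u) :=
    integrable_mul_gaussianDensity hT (hf.mul (continuous_polyFun Q).aestronglyMeasurable)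
      (hfg.mul (polyGrowth_polyFun Q))
  obtain ⟨M, hM⟩ := hχd (coordVec c)
  have hdχ (n) := contDiff_fderiv_apply (hχ n) (coordVec c)
  have hddχ (n) := contDiff_fderiv_apply (hdχ n) (coordVec c)
  have hM0 : 0 ≤ M := by simpa using (abs_nonneg _).trans (hM 0 0).1
  have hle (n : ℕ) : M * ((n : ℝ) + 1)⁻¹ ≤ M :=
    mul_le_of_le_one_right hM0 (inv_le_one_of_one_le₀ (by linarith [n.cast_nonneg (α := ℝ)]))
  have hlim : Tendsto (fun n : ℕ => M * ((n : ℝ) + 1)⁻¹) atTop (𝓝 0) := by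
    simpa using (tendsto_one_div_add_atTop_nhds_zero_nat (𝕜 := ℝ)).const_mul M
  -- The coefficients of $\partial\chi_n$ and $\partial^2\chi_n$ in the operator applied to
  -- $P\chi_n$.
  let Q₁ := C (T c.1) * pderiv c P - C (1 / 2) * X c * P
  let Q₂ := C (T c.1 / 2) * P
  have t0 := tendsto_integral_mul_of_bounded (hw (ouPoly T c P)) (fun n => (hχ n).continuous)
    hχ1 hχl
  have t1 := tendsto_integral_mul_of_bounded (hw Q₁) (fun n => (hdχ n).continuous)
    (fun n u => (hM n u).1.trans (hle n))
    (fun u => squeeze_zero_norm (fun n => (hM n u).1) hlim)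
  have t2 := tendsto_integral_mul_of_bounded (hw Q₂) (fun n => (hddχ n).continuous)
    (fun n u => (hM n u).2.trans (hle n))
    (fun u => squeeze_zero_norm (fun n => (hM n u).2) hlim)
  have hint (Q : MvPolynomial (ι × Fin 2) ℝ) {h : (ι → ℂ) → ℝ} (hc : Continuous h) {M' : ℝ}
      (hb : ∀ u, |h u| ≤ M') :
      Integrable (fun u => f u * polyFun Q u * gaussianDensity T u * h u) :=
    (hw Q).mul_bdd hc.aestronglyMeasurable (Eventually.of_forall hb)
  have key (n) : ∫ u, f u * gaussianDensity T u *
        (T c.1 / 2 * fderiv ℝ (fun v => fderiv ℝ (fun v => polyFun P v * χ n v) v (coordVec c)) u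
            (coordVec c)
          - coord c u / 2 * fderiv ℝ (fun v => polyFun P v * χ n v) u (coordVec c)) =
      (∫ u, f u * polyFun (ouPoly T c P) u * gaussianDensity T u * χ n u) +
      (∫ u, f u * polyFun Q₁ u * gaussianDensity T u * fderiv ℝ (χ n) u (coordVec c)) +
      ∫ u, f u * polyFun Q₂ u * gaussianDensity T u *
        fderiv ℝ (fun v => fderiv ℝ (χ n) v (coordVec c)) u (coordVec c) := by
    have i0 := hint (ouPoly T c P) (hχ n).continuous (hχ1 n)
    have i1 := hint Q₁ (hdχ n).continuous fun u => (hM n u).1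
    have i2 := hint Q₂ (hddχ n).continuous fun u => (hM n u).2
    rw [← integral_add i0 i1, ← integral_add (i0.fun_add i1) i2]
    congr 1 with u
    have dP := differentiable_polyFun P
    have dχ := (hχ n).differentiable (by simp)
    have ddP := differentiable_polyFun (pderiv c P)
    have ddχ := (hdχ n).differentiable (by simp)
    have h1 (v) : fderiv ℝ (fun v => polyFun P v * χ n v) v (coordVec c) =
        polyFun (pderiv c P) v * χ n v + polyFun P v * fderiv ℝ (χ n) v (coordVec c) := by
      rw [fderiv_fun_mul (dP v) (dχ v)]
      simp [fderiv_polyFun]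
      ring
    have h2 : fderiv ℝ (fun v => fderiv ℝ (fun v => polyFun P v * χ n v) v (coordVec c)) u
        (coordVec c) = polyFun (pderiv c (pderiv c P)) u * χ n u +
          2 * (polyFun (pderiv c P) u * fderiv ℝ (χ n) u (coordVec c)) +
          polyFun P u * fderiv ℝ (fun v => fderiv ℝ (χ n) v (coordVec c)) u (coordVec c) := by
      rw [funext h1, fderiv_fun_add ((ddP u).fun_mul (dχ u)) ((dP u).fun_mul (ddχ u)),
        fderiv_fun_mul (ddP u) (dχ u), fderiv_fun_mul (dP u) (ddχ u)]
      simp [fderiv_polyFun]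
      ring
    rw [h1, h2]
    simp only [ouPoly, Q₁, Q₂, polyFun_sub, polyFun_mul, polyFun_C, polyFun_X]
    ring
  simp_rw [key]
  simpa using (t0.add t1).add t2

/-- The generator `A^{kj}` is symmetric with respect to the Gaussian measure, on pairs of a
weakly twice differentiable function of polynomial growth and a polynomial. -/
lemma integral_mul_ouPairPoly [DecidableEq ι] {T : ι → ℝ} (hT : ∀ m, 0 < T m) {k j : ι}
    {f ξ : (ι → ℂ) → ℝ} (hfg : PolyGrowth f) (hξc : Continuous ξ) (hξg : PolyGrowth ξ)
    {G : ι × Fin 2 → (ι → ℂ) → ℝ} {H : ι × Fin 2 → ι × Fin 2 → (ι → ℂ) → ℝ}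
    (hJ : IsWeakJet f G H)
    (heq : ∀ᵐ u ∂(volume : Measure (ι → ℂ)), ouSite T k G H u + ouSite T j G H u = ξ u)
    (P : MvPolynomial (ι × Fin 2) ℝ) :
    ∫ u, f u * polyFun (ouPairPoly T k j P) u ∂(gaussianMeasure T) =
      ∫ u, ξ u * polyFun P u ∂(gaussianMeasure T) := by
  rw [integral_gaussianMeasure hT, integral_gaussianMeasure hT]
  obtain ⟨χ, hχ, hχs, hχ1, hχl, hχd⟩ := exists_cutoff ι
  have hf : AEStronglyMeasurable f volume := (hJ.1 (k, 0)).1.aestronglyMeasurable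
  have hw (Q : MvPolynomial (ι × Fin 2) ℝ) :
      Integrable (fun u => f u * polyFun Q u * gaussianDensity T u) :=
    integrable_mul_gaussianDensity hT (hf.mul (continuous_polyFun Q).aestronglyMeasurable)
      (hfg.mul (polyGrowth_polyFun Q))
  have lim (c) := tendsto_integral_ou_cutoff hT hf hfg c P hχ hχ1 hχl hχd
  have test (c) (n) := integral_ou_mul_test hT c (hJ.1 c) (hJ.2 c c)
    ((contDiff_polyFun P).mul (hχ n)) (hχs n).mul_left
  have hsum : ∫ u, f u * polyFun (ouPairPoly T k j P) u * gaussianDensity T u =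
      (∫ u, f u * polyFun (ouPoly T (k, 0) P) u * gaussianDensity T u) +
      (∫ u, f u * polyFun (ouPoly T (k, 1) P) u * gaussianDensity T u) +
      ((∫ u, f u * polyFun (ouPoly T (j, 0) P) u * gaussianDensity T u) +
      ∫ u, f u * polyFun (ouPoly T (j, 1) P) u * gaussianDensity T u) := by
    rw [← integral_add (hw _) (hw _), ← integral_add (hw _) (hw _),
      ← integral_add ((hw _).fun_add (hw _)) ((hw _).fun_add (hw _))]
    congr 1 with u
    simp only [ouPairPoly, polyFun_add]
    ring
  have hlim := ((lim (k, 0)).add (lim (k, 1))).add ((lim (j, 0)).add (lim (j, 1)))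
  rw [← hsum] at hlim
  have hlim' := tendsto_integral_mul_of_bounded
    (integrable_mul_gaussianDensity hT (f := fun u => ξ u * polyFun P u)
      (hξc.mul (continuous_polyFun P)).aestronglyMeasurable (hξg.mul (polyGrowth_polyFun P)))
    (fun n => (hχ n).continuous) hχ1 hχl
  simp only [mul_one] at hlim'
  -- At each finite $n$ the two sequences agree, by symmetry against the test function $P\chi_n$ and
  -- the equation for $f$.
  refine tendsto_nhds_unique hlim (hlim'.congr fun n => ?_)
  rw [← (test (k, 0) n).2, ← (test (k, 1) n).2, ← (test (j, 0) n).2, ← (test (j, 1) n).2,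
    ← integral_add (test _ n).1 (test _ n).1, ← integral_add (test _ n).1 (test _ n).1,
    ← integral_add ((test _ n).1.fun_add (test _ n).1)
      ((test _ n).1.fun_add (test _ n).1)]
  refine integral_congr_ae ?_
  filter_upwards [heq] with u hu
  rw [← hu]
  simp only [ouSite, coord_zero, coord_one]
  ring

end Symmetry

/-! ### Algebra of the generator on the rotation invariants, and the explicit polynomial solutions.
-/

section Quartic

variable {ι : Type*}

/-- The polynomial `|u_l|²`. -/
def sqPoly (l : ι) : MvPolynomial (ι × Fin 2) ℝ := X (l, 0) ^ 2 + X (l, 1) ^ 2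

/-- The polynomial `Re (u_k ū_j)`. -/
def rePoly (k j : ι) : MvPolynomial (ι × Fin 2) ℝ := X (k, 0) * X (j, 0) + X (k, 1) * X (j, 1)

/-- The polynomial `Im (u_k ū_j)`. -/
def imPoly (k j : ι) : MvPolynomial (ι × Fin 2) ℝ := X (k, 1) * X (j, 0) - X (k, 0) * X (j, 1)

/-- The resonant energy flow `3 |u_k - u_j|² Im (u_k ū_j)` of the quartic potential. -/
def flowPoly (k j : ι) : MvPolynomial (ι × Fin 2) ℝ :=
  C 3 * ((sqPoly k + sqPoly j) * imPoly k j) - C 6 * (rePoly k j * imPoly k j)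

/-- The general element of an invariant space of `A^{kj}` in which the Poisson equation is solved. -/
def spanPoly (k j : ι) (x y z : ℝ) : MvPolynomial (ι × Fin 2) ℝ :=
  C x * ((sqPoly k + sqPoly j) * imPoly k j) + C y * imPoly k j + C z * (rePoly k j * imPoly k j)

/-- The polynomial solution of the Poisson equation for the quartic potential. -/
def solutionPoly (T : ι → ℝ) (k j : ι) : MvPolynomial (ι × Fin 2) ℝ :=
  spanPoly k j (-(3 / 2)) (-6 * (T k + T j)) 3

/-- A polynomial `g` with `A^{kj} g = 𝒥 η + 360 T_k T_j (T_k + T_j)²`, for the resonant flow `𝒥` and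
the solution `η` of the Poisson equation. -/
def pairingPotential (T : ι → ℝ) (k j : ι) : MvPolynomial (ι × Fin 2) ℝ :=
    C (9 / 8) * (sqPoly k ^ 3 * sqPoly j) +
    C (9 / 4) * (sqPoly k ^ 2 * sqPoly j ^ 2) +
    C (-9 / 2) * (sqPoly k ^ 2 * sqPoly j * rePoly k j) +
    C (-9 / 8) * (sqPoly k ^ 2 * rePoly k j ^ 2) +
    C (9 / 8) * (sqPoly k * sqPoly j ^ 3) +
    C (-9 / 2) * (sqPoly k * sqPoly j ^ 2 * rePoly k j) +
    C (9 / 4) * (sqPoly k * sqPoly j * rePoly k j ^ 2) +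
    C (9 / 2) * (sqPoly k * rePoly k j ^ 3) +
    C (-9 / 8) * (sqPoly j ^ 2 * rePoly k j ^ 2) +
    C (9 / 2) * (sqPoly j * rePoly k j ^ 3) +
    C (-9 / 2) * (rePoly k j ^ 4) +
    C (3 / 8 * T j) * (sqPoly k ^ 3) +
    C (99 / 8 * T k + 51 / 4 * T j) * (sqPoly k ^ 2 * sqPoly j) +
    C (-3 / 2 * T j) * (sqPoly k ^ 2 * rePoly k j) +
    C (51 / 4 * T k + 99 / 8 * T j) * (sqPoly k * sqPoly j ^ 2) +
    C (-51 / 2 * T k - 51 / 2 * T j) * (sqPoly k * sqPoly j * rePoly k j) +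
    C (-12 * T k - 21 / 2 * T j) * (sqPoly k * rePoly k j ^ 2) +
    C (3 / 8 * T k) * (sqPoly j ^ 3) +
    C (-3 / 2 * T k) * (sqPoly j ^ 2 * rePoly k j) +
    C (-21 / 2 * T k - 12 * T j) * (sqPoly j * rePoly k j ^ 2) +
    C (24 * T k + 24 * T j) * (rePoly k j ^ 3) +
    C (39 / 4 * T k * T j + 15 / 2 * T j ^ 2) * (sqPoly k ^ 2) +
    C (87 / 2 * T k ^ 2 + 183 / 2 * T k * T j + 87 / 2 * T j ^ 2) * (sqPoly k * sqPoly j) +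
    C (-24 * T k * T j - 15 * T j ^ 2) * (sqPoly k * rePoly k j) +
    C (15 / 2 * T k ^ 2 + 39 / 4 * T k * T j) * (sqPoly j ^ 2) +
    C (-15 * T k ^ 2 - 24 * T k * T j) * (sqPoly j * rePoly k j) +
    C (-36 * T k ^ 2 - 63 * T k * T j - 36 * T j ^ 2) * (rePoly k j ^ 2) +
    C (129 * T k ^ 2 * T j + 180 * T k * T j ^ 2 + 51 * T j ^ 3) * (sqPoly k) +
    C (51 * T k ^ 3 + 180 * T k ^ 2 * T j + 129 * T k * T j ^ 2) * (sqPoly j) +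
    C (-156 * T k ^ 2 * T j - 156 * T k * T j ^ 2) * (rePoly k j)

lemma polyFun_ofNat (n : ℕ) [n.AtLeastTwo] (u : ι → ℂ) :
    polyFun (ofNat(n) : MvPolynomial (ι × Fin 2) ℝ) u = ofNat(n) := by
  simp [polyFun]

/-- The carré du champ operator of the one-dimensional Ornstein-Uhlenbeck operator. -/
def carrePoly (T : ι → ℝ) (c : ι × Fin 2) (P Q : MvPolynomial (ι × Fin 2) ℝ) :
    MvPolynomial (ι × Fin 2) ℝ :=
  2 * C (T c.1 / 2) * (pderiv c P * pderiv c Q)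

/-- The carré du champ operator of the generator `A^{kj}`. -/
def carrePairPoly (T : ι → ℝ) (k j : ι) (P Q : MvPolynomial (ι × Fin 2) ℝ) :
    MvPolynomial (ι × Fin 2) ℝ :=
  carrePoly T (k, 0) P Q + carrePoly T (k, 1) P Q +
    (carrePoly T (j, 0) P Q + carrePoly T (j, 1) P Q)

lemma carrePairPoly_mul_left (T : ι → ℝ) (k j : ι) (P Q S : MvPolynomial (ι × Fin 2) ℝ) :
    carrePairPoly T k j (P * Q) S = P * carrePairPoly T k j Q S + carrePairPoly T k j P S * Q := by
  simp only [carrePairPoly, carrePoly, pderiv_mul]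
  ring

lemma carrePairPoly_mul_right (T : ι → ℝ) (k j : ι) (P Q S : MvPolynomial (ι × Fin 2) ℝ) :
    carrePairPoly T k j P (Q * S) = Q * carrePairPoly T k j P S + carrePairPoly T k j P Q * S := by
  simp only [carrePairPoly, carrePoly, pderiv_mul]
  ring

lemma carrePairPoly_add_left (T : ι → ℝ) (k j : ι) (P Q S : MvPolynomial (ι × Fin 2) ℝ) :
    carrePairPoly T k j (P + Q) S = carrePairPoly T k j P S + carrePairPoly T k j Q S := by
  simp only [carrePairPoly, carrePoly, map_add]
  ring

lemma carrePairPoly_C_left (T : ι → ℝ) (k j : ι) (a : ℝ) (P : MvPolynomial (ι × Fin 2) ℝ) :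
    carrePairPoly T k j (C a) P = 0 := by
  simp [carrePairPoly, carrePoly]

/-- This is $|u_k\bar u_j|^2=|u_k|^2|u_j|^2$. It removes the imaginary part from products of two odd
invariants. -/
lemma polyFun_imPoly_sq (k j : ι) (u : ι → ℂ) :
    polyFun (imPoly k j) u ^ 2 =
      polyFun (sqPoly k) u * polyFun (sqPoly j) u - polyFun (rePoly k j) u ^ 2 := by
  simp [sqPoly, rePoly, imPoly]
  ring

variable [DecidableEq ι]

lemma ouPairPoly_add (T : ι → ℝ) (k j : ι) (P Q : MvPolynomial (ι × Fin 2) ℝ) :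
    ouPairPoly T k j (P + Q) = ouPairPoly T k j P + ouPairPoly T k j Q := by
  simp only [ouPairPoly, ouPoly, map_add]
  ring

lemma ouPairPoly_C (T : ι → ℝ) (k j : ι) (a : ℝ) : ouPairPoly T k j (C a) = 0 := by
  simp [ouPairPoly, ouPoly]

/-- The Leibniz rule of a second-order operator without zeroth-order term. It reduces the generator
to its values and carré du champ on the quadratic invariants, tabulated below. -/
lemma ouPairPoly_mul (T : ι → ℝ) (k j : ι) (P Q : MvPolynomial (ι × Fin 2) ℝ) :
    ouPairPoly T k j (P * Q) =
      ouPairPoly T k j P * Q + P * ouPairPoly T k j Q + carrePairPoly T k j P Q := by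
  simp only [ouPairPoly, ouPoly, carrePairPoly, carrePoly, pderiv_mul, map_add]
  ring

/-- The scalars keep the form `C (T k / 2)` and `C (1 / 2)` of the definition, as atoms for `ring`;
they become real numbers only under `polyFun`. -/
lemma ouPairPoly_sqPoly_left (T : ι → ℝ) {k j : ι} (hkj : k ≠ j) :
    ouPairPoly T k j (sqPoly k) = 4 * C (T k / 2) - 2 * C (1 / 2) * sqPoly k := by
  simp [ouPairPoly, ouPoly, sqPoly, pow_two, pderiv_X, hkj]
  ring

lemma ouPairPoly_sqPoly_right (T : ι → ℝ) {k j : ι} (hkj : k ≠ j) :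
    ouPairPoly T k j (sqPoly j) = 4 * C (T j / 2) - 2 * C (1 / 2) * sqPoly j := by
  simp [ouPairPoly, ouPoly, sqPoly, pow_two, pderiv_X, hkj.symm]
  ring

lemma ouPairPoly_rePoly (T : ι → ℝ) {k j : ι} (hkj : k ≠ j) :
    ouPairPoly T k j (rePoly k j) = -(2 * C (1 / 2) * rePoly k j) := by
  simp [ouPairPoly, ouPoly, rePoly, pderiv_X, hkj, hkj.symm]
  ring

lemma ouPairPoly_imPoly (T : ι → ℝ) {k j : ι} (hkj : k ≠ j) :
    ouPairPoly T k j (imPoly k j) = -(2 * C (1 / 2) * imPoly k j) := by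
  simp [ouPairPoly, ouPoly, imPoly, pderiv_X, hkj, hkj.symm]
  ring

lemma carrePairPoly_sqPoly_left_sqPoly_left (T : ι → ℝ) {k j : ι} (hkj : k ≠ j) :
    carrePairPoly T k j (sqPoly k) (sqPoly k) = 8 * C (T k / 2) * sqPoly k := by
  simp [carrePairPoly, carrePoly, sqPoly, pow_two, pderiv_X, hkj]
  ring

lemma carrePairPoly_sqPoly_left_sqPoly_right (T : ι → ℝ) {k j : ι} (hkj : k ≠ j) :
    carrePairPoly T k j (sqPoly k) (sqPoly j) = 0 := by
  simp [carrePairPoly, carrePoly, sqPoly, pow_two, pderiv_X, hkj, hkj.symm]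

lemma carrePairPoly_sqPoly_right_sqPoly_right (T : ι → ℝ) {k j : ι} (hkj : k ≠ j) :
    carrePairPoly T k j (sqPoly j) (sqPoly j) = 8 * C (T j / 2) * sqPoly j := by
  simp [carrePairPoly, carrePoly, sqPoly, pow_two, pderiv_X, hkj.symm]
  ring

lemma carrePairPoly_sqPoly_left_rePoly (T : ι → ℝ) {k j : ι} (hkj : k ≠ j) :
    carrePairPoly T k j (sqPoly k) (rePoly k j) = 4 * C (T k / 2) * rePoly k j := by
  simp [carrePairPoly, carrePoly, sqPoly, rePoly, pow_two, pderiv_X, hkj, hkj.symm]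
  ring

lemma carrePairPoly_sqPoly_right_rePoly (T : ι → ℝ) {k j : ι} (hkj : k ≠ j) :
    carrePairPoly T k j (sqPoly j) (rePoly k j) = 4 * C (T j / 2) * rePoly k j := by
  simp [carrePairPoly, carrePoly, sqPoly, rePoly, pow_two, pderiv_X, hkj, hkj.symm]
  ring

lemma carrePairPoly_rePoly_rePoly (T : ι → ℝ) {k j : ι} (hkj : k ≠ j) :
    carrePairPoly T k j (rePoly k j) (rePoly k j) =
      2 * C (T k / 2) * sqPoly j + 2 * C (T j / 2) * sqPoly k := by
  simp [carrePairPoly, carrePoly, sqPoly, rePoly, pderiv_X, hkj, hkj.symm]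
  ring

lemma carrePairPoly_sqPoly_left_imPoly (T : ι → ℝ) {k j : ι} (hkj : k ≠ j) :
    carrePairPoly T k j (sqPoly k) (imPoly k j) = 4 * C (T k / 2) * imPoly k j := by
  simp [carrePairPoly, carrePoly, sqPoly, imPoly, pow_two, pderiv_X, hkj, hkj.symm]
  ring

lemma carrePairPoly_sqPoly_right_imPoly (T : ι → ℝ) {k j : ι} (hkj : k ≠ j) :
    carrePairPoly T k j (sqPoly j) (imPoly k j) = 4 * C (T j / 2) * imPoly k j := by
  simp [carrePairPoly, carrePoly, sqPoly, imPoly, pow_two, pderiv_X, hkj, hkj.symm]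
  ring

/-- In each variable separately $u_k\bar u_j$ is holomorphic or antiholomorphic, so its real and
imaginary parts have orthogonal gradients. -/
lemma carrePairPoly_rePoly_imPoly (T : ι → ℝ) {k j : ι} (hkj : k ≠ j) :
    carrePairPoly T k j (rePoly k j) (imPoly k j) = 0 := by
  simp [carrePairPoly, carrePoly, rePoly, imPoly, pderiv_X, hkj, hkj.symm]
  ring

/-- The matrix of $A$ is triangular with eigenvalues $-2,-1,-2$. The only off-diagonal entry comes
from $|u_k|^2+|u_j|^2$; the product of real and imaginary parts is $\frac12\mathrm{Im}(u_k^2\bar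
u_j^2)$, harmonic in each variable. -/
lemma polyFun_ouPairPoly_spanPoly (T : ι → ℝ) {k j : ι} (hkj : k ≠ j) (x y z : ℝ) (u : ι → ℂ) :
    polyFun (ouPairPoly T k j (spanPoly k j x y z)) u =
      polyFun (spanPoly k j (-2 * x) (4 * (T k + T j) * x - y) (-2 * z)) u := by
  simp only [spanPoly, ouPairPoly_add, ouPairPoly_mul, ouPairPoly_C, carrePairPoly_C_left,
    carrePairPoly_add_left, ouPairPoly_sqPoly_left T hkj,
    ouPairPoly_sqPoly_right T hkj,
    ouPairPoly_rePoly T hkj,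
    ouPairPoly_imPoly T hkj,
    carrePairPoly_sqPoly_left_imPoly T hkj,
    carrePairPoly_sqPoly_right_imPoly T hkj,
    carrePairPoly_rePoly_imPoly T hkj,
    polyFun_ofNat, polyFun_add, polyFun_sub, polyFun_neg, polyFun_mul, polyFun_C, polyFun_zero]
  ring

lemma polyFun_ouPairPoly_pairingPotential (T : ι → ℝ) {k j : ι} (hkj : k ≠ j) (u : ι → ℂ) :
    polyFun (ouPairPoly T k j (pairingPotential T k j)) u =
      polyFun (flowPoly k j) u * polyFun (solutionPoly T k j) u
        + 360 * (T k * T j) * (T k + T j) ^ 2 := by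
  have hW := polyFun_imPoly_sq k j u
  simp only [pairingPotential, ouPairPoly_add, ouPairPoly_mul, ouPairPoly_C,
    carrePairPoly_C_left, carrePairPoly_mul_left, carrePairPoly_mul_right, pow_succ, pow_zero,
    one_mul,
    ouPairPoly_sqPoly_left T hkj,
    ouPairPoly_sqPoly_right T hkj,
    ouPairPoly_rePoly T hkj,
    carrePairPoly_sqPoly_left_sqPoly_left T hkj,
    carrePairPoly_sqPoly_left_sqPoly_right T hkj,
    carrePairPoly_sqPoly_right_sqPoly_right T hkj,
    carrePairPoly_sqPoly_left_rePoly T hkj,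
    carrePairPoly_sqPoly_right_rePoly T hkj,
    carrePairPoly_rePoly_rePoly T hkj,
    polyFun_ofNat, polyFun_add, polyFun_sub, polyFun_neg, polyFun_mul, polyFun_C, polyFun_zero,
    solutionPoly, flowPoly, spanPoly]
  -- Both $\mathcal J$ and $\eta_0$ are multiples of $\mathrm{Im}(u_k\bar u_j)$; the coefficient is
  -- minus the product of their cofactors, which eliminates its square.
  linear_combination (-(3 * (polyFun (sqPoly k) u + polyFun (sqPoly j) u)
    - 6 * polyFun (rePoly k j) u) * (-(3 / 2) * (polyFun (sqPoly k) u + polyFun (sqPoly j) u)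
    - 6 * (T k + T j) + 3 * polyFun (rePoly k j) u)) * hW

end Quartic

/-! ### The resonant flow of the quartic potential and the value of the pairing. -/

section Conductivity

/-- Over a period $\cos^4$ and $\sin^4$ have mean $3/8$, $\cos^2\sin^2$ has mean $1/8$, and the odd
products have mean $0$. An explicit antiderivative gives all of them at once. -/
lemma integral_quartic_cos_sin (a₀ a₁ a₂ a₃ a₄ : ℝ) :
    ∫ θ in (0 : ℝ)..(2 * Real.pi),
        (a₀ * Real.cos θ ^ 4 + a₁ * (Real.cos θ ^ 3 * Real.sin θ)
          + a₂ * (Real.cos θ ^ 2 * Real.sin θ ^ 2) + a₃ * (Real.cos θ * Real.sin θ ^ 3)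
          + a₄ * Real.sin θ ^ 4) = 2 * Real.pi * ((3 * a₀ + a₂ + 3 * a₄) / 8) := by
  have hderiv (θ : ℝ) : HasDerivAt (fun θ =>
      (3 * a₀ + a₂ + 3 * a₄) / 8 * θ + (3 * a₀ + a₂ - 3 * a₄) / 8 * (Real.sin θ * Real.cos θ)
        + (a₀ - a₂) / 4 * (Real.cos θ ^ 3 * Real.sin θ) - a₄ / 4 * (Real.sin θ ^ 3 * Real.cos θ)
        - a₁ / 4 * Real.cos θ ^ 4 + a₃ / 4 * Real.sin θ ^ 4)
      (a₀ * Real.cos θ ^ 4 + a₁ * (Real.cos θ ^ 3 * Real.sin θ)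
          + a₂ * (Real.cos θ ^ 2 * Real.sin θ ^ 2) + a₃ * (Real.cos θ * Real.sin θ ^ 3)
          + a₄ * Real.sin θ ^ 4) θ := by
    have hs := Real.hasDerivAt_sin θ
    have hc := Real.hasDerivAt_cos θ
    refine ((((((hasDerivAt_id θ).const_mul _).add ((hs.mul hc).const_mul _)).add
      (((hc.pow 3).mul hs).const_mul _)).sub (((hs.pow 3).mul hc).const_mul _)).sub
      ((hc.pow 4).const_mul _)).add ((hs.pow 4).const_mul _) |>.congr_deriv ?_
    have h1 : Real.sin θ ^ 2 = 1 - Real.cos θ ^ 2 := Real.sin_sq θ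
    have h4 : Real.sin θ ^ 4 = (1 - Real.cos θ ^ 2) ^ 2 := by rw [← h1]; ring
    simp only [Pi.pow_apply, mul_one, Nat.cast_ofNat, Nat.add_one_sub_one]
    ring_nf
    simp only [h1, h4]
    ring
  rw [intervalIntegral.integral_eq_sub_of_hasDerivAt (fun θ _ => hderiv θ)
    (Continuous.intervalIntegrable (by fun_prop) _ _)]
  simp
  ring

variable {ι : Type*}

lemma energyFlow_quarticPotential (k j : ι) (u : ι → ℂ) :
    energyFlow quarticPotential k j u =
      4 * ((u k).re + (u j).re) * ((u k).im - (u j).im) ^ 3 := by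
  have h1 (x y : ℝ) : deriv (fun x : ℝ => (x - y) ^ 4) x = 4 * (x - y) ^ 3 := by
    simp
  have h2 (x y : ℝ) : deriv (fun y : ℝ => (x - y) ^ 4) y = -(4 * (x - y) ^ 3) := by
    simpa using (((hasDerivAt_id y).const_sub x).fun_pow 4).deriv
  simp only [energyFlow, quarticPotential, h1, h2]
  ring

/-- The flow is $4\alpha\delta^3$ with $\alpha=\mathrm{Re}(u_k+u_j)$ and
$\delta=\mathrm{Im}(u_k-u_j)$. Under rotation it is a quartic form in $\cos\theta,\sin\theta$, with
average $\frac32(\alpha\delta-\beta\gamma)(\gamma^2+\delta^2)$. -/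
lemma resonantFlow_quarticPotential (k j : ι) :
    resonantFlow quarticPotential k j = polyFun (flowPoly k j) := by
  ext u
  have hrot (θ : ℝ) (z : ℂ) :
      (Complex.exp (θ * Complex.I) * z).re = Real.cos θ * z.re - Real.sin θ * z.im ∧
      (Complex.exp (θ * Complex.I) * z).im = Real.cos θ * z.im + Real.sin θ * z.re := by
    simp [Complex.exp_ofReal_mul_I_re, Complex.exp_ofReal_mul_I_im]
  set α := (u k).re + (u j).re with hα
  set β := (u k).im + (u j).im with hβ
  set γ := (u k).re - (u j).re with hγ
  set δ := (u k).im - (u j).im with hδ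
  have hint := integral_quartic_cos_sin (4 * (α * δ ^ 3)) (4 * (3 * α * δ ^ 2 * γ - β * δ ^ 3))
    (4 * (3 * α * δ * γ ^ 2 - 3 * β * δ ^ 2 * γ)) (4 * (α * γ ^ 3 - 3 * β * δ * γ ^ 2))
    (-4 * (β * γ ^ 3))
  have hflow (θ : ℝ) :
      energyFlow quarticPotential k j (fun m => Complex.exp (θ * Complex.I) * u m) =
        4 * (α * δ ^ 3) * Real.cos θ ^ 4
          + 4 * (3 * α * δ ^ 2 * γ - β * δ ^ 3) * (Real.cos θ ^ 3 * Real.sin θ)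
          + 4 * (3 * α * δ * γ ^ 2 - 3 * β * δ ^ 2 * γ) * (Real.cos θ ^ 2 * Real.sin θ ^ 2)
          + 4 * (α * γ ^ 3 - 3 * β * δ * γ ^ 2) * (Real.cos θ * Real.sin θ ^ 3)
          + -4 * (β * γ ^ 3) * Real.sin θ ^ 4 := by
    simp only [energyFlow_quarticPotential, hrot, hα, hβ, hγ, hδ]
    ring
  rw [resonantFlow, resonantAverage]
  simp_rw [hflow]
  rw [hint, inv_mul_cancel_left₀ (by positivity)]
  simp only [flowPoly, sqPoly, rePoly, imPoly, polyFun_sub, polyFun_add, polyFun_mul, polyFun_pow,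
    polyFun_C, polyFun_X, coord_zero, coord_one, hα, hβ, hγ, hδ]
  ring

lemma polyFun_ouPairPoly_solutionPoly [DecidableEq ι] (T : ι → ℝ) {k j : ι} (hkj : k ≠ j)
    (u : ι → ℂ) :
    polyFun (ouPairPoly T k j (solutionPoly T k j)) u = polyFun (flowPoly k j) u := by
  rw [solutionPoly, polyFun_ouPairPoly_spanPoly T hkj]
  simp only [spanPoly, flowPoly, polyFun_add, polyFun_sub, polyFun_mul, polyFun_C]
  ring

variable [Fintype ι]

lemma integrable_polyFun_mul {T : ι → ℝ} (hT : ∀ m, 0 < T m) (P : MvPolynomial (ι × Fin 2) ℝ)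
    {f : (ι → ℂ) → ℝ} (hf : AEStronglyMeasurable f volume) (hg : PolyGrowth f) :
    Integrable (fun u => polyFun P u * f u) (gaussianMeasure T) :=
  integrable_gaussianMeasure hT (integrable_mul_gaussianDensity hT
    ((continuous_polyFun P).aestronglyMeasurable.mul hf) ((polyGrowth_polyFun P).mul hg))

variable [DecidableEq ι]

/-- Stationarity of the Gaussian measure: symmetry against the constant $1$, which $A$ annihilates.
-/
lemma integral_polyFun_ouPairPoly {T : ι → ℝ} (hT : ∀ m, 0 < T m) (k j : ι)
    (P : MvPolynomial (ι × Fin 2) ℝ) :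
    ∫ u, polyFun (ouPairPoly T k j P) u ∂(gaussianMeasure T) = 0 := by
  simpa using integral_mul_ouPairPoly hT (k := k) (j := j) (ξ := fun _ => 0)
    (polyGrowth_polyFun 1) continuous_const (polyGrowth_const 0) (isWeakJet_polyFun 1)
    (Eventually.of_forall fun u => by simp [ouSite]) P

lemma isPoissonSolution_solutionPoly {T : ι → ℝ} (hT : ∀ m, 0 < T m) {k j : ι} (hkj : k ≠ j) :
    IsPoissonSolution T k j (resonantFlow quarticPotential k j)
      (polyFun (solutionPoly T k j)) where
  sobolev p _ _ := memW2Loc_polyFun _ p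
  growth := polyGrowth_polyFun _
  mean_zero := by
    -- The coefficients invert the triangular matrix of $A$, so that $A$ of this element is the
    -- solution.
    rw [← integral_polyFun_ouPairPoly hT k j (spanPoly k j (3 / 4) (9 * (T k + T j)) (-(3 / 2)))]
    congr 1 with u
    rw [polyFun_ouPairPoly_spanPoly T hkj, solutionPoly]
    simp only [spanPoly, polyFun_add, polyFun_mul, polyFun_C]
    ring
  support u v h := by
    have hk : u k = v k := h k (by simp)
    have hj : u j = v j := h j (by simp)
    simp [solutionPoly, spanPoly, sqPoly, rePoly, imPoly, hk, hj]
  equation := by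
    refine ⟨_, _, isWeakJet_polyFun _, Eventually.of_forall fun u => ?_⟩
    rw [resonantFlow_quarticPotential, ← polyFun_ouPairPoly_solutionPoly T hkj]
    simp only [ouSite, ouPairPoly, ouPoly, polyFun_add, polyFun_sub, polyFun_mul, polyFun_C,
      polyFun_X, coord_zero, coord_one]
    ring

lemma integral_flowPoly_mul_solutionPoly {T : ι → ℝ} (hT : ∀ m, 0 < T m) {k j : ι}
    (hkj : k ≠ j) :
    ∫ u, polyFun (flowPoly k j) u * polyFun (solutionPoly T k j) u ∂(gaussianMeasure T) =
      -(360 * (T k * T j) * (T k + T j) ^ 2) := by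
  have h := integral_polyFun_ouPairPoly hT k j (pairingPotential T k j)
  simp_rw [polyFun_ouPairPoly_pairingPotential T hkj] at h
  have hconst (a : ℝ) : Integrable (fun _ : ι → ℂ => a) (gaussianMeasure T) :=
    integrable_gaussianMeasure hT
      (integrable_mul_gaussianDensity hT aestronglyMeasurable_const (polyGrowth_const a))
  rw [integral_add (integrable_polyFun_mul hT _
    (continuous_polyFun _).aestronglyMeasurable (polyGrowth_polyFun _)) (hconst _),
    integral_gaussianMeasure hT (fun _ => 360 * (T k * T j) * (T k + T j) ^ 2),
    integral_const_mul, integral_gaussianDensity hT] at h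
  linarith

/-- Symmetry with $\eta_0$ as the polynomial transfers the pairing from $\eta$ to $\eta_0$; the zero
mean of $\eta$ plays no role, since $\mathcal J$ lies in the range of $A$. -/
lemma integral_flow_mul_of_isPoissonSolution {T : ι → ℝ} (hT : ∀ m, 0 < T m) {k j : ι}
    (hkj : k ≠ j) {η : (ι → ℂ) → ℝ}
    (hη : IsPoissonSolution T k j (resonantFlow quarticPotential k j) η) :
    Integrable (fun u => resonantFlow quarticPotential k j u * η u) (gaussianMeasure T) ∧
      ∫ u, resonantFlow quarticPotential k j u * η u ∂(gaussianMeasure T) =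
        -(360 * (T k * T j) * (T k + T j) ^ 2) := by
  obtain ⟨G, H, hJ, heq⟩ := hη.equation
  rw [resonantFlow_quarticPotential] at heq ⊢
  refine ⟨integrable_polyFun_mul hT _ (hJ.1 (k, 0)).1.aestronglyMeasurable hη.growth, ?_⟩
  rw [← integral_flowPoly_mul_solutionPoly hT hkj, ← integral_mul_ouPairPoly hT hη.growth
    (continuous_polyFun _) (polyGrowth_polyFun _) hJ heq (solutionPoly T k j)]
  simp_rw [polyFun_ouPairPoly_solutionPoly T hkj, mul_comm]

end Conductivity

end OscillatorChain

end

theorem proposition3p7 :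
    ∃ C : ℝ, 0 < C ∧
      OscillatorChain.IsConductivity OscillatorChain.quarticPotential
        (fun x y => C * (x + y) ^ 2) := by
  refine ⟨360, by norm_num, fun d S T hT k j hd => ?_⟩
  have hkj : k ≠ j := by
    rintro rfl
    simp at hd
  refine ⟨⟨_, OscillatorChain.isPoissonSolution_solutionPoly hT hkj⟩, fun η hη => ?_⟩
  obtain ⟨hi, he⟩ := OscillatorChain.integral_flow_mul_of_isPoissonSolution hT hkj hη
  refine ⟨hi, ?_⟩
  have hk := (hT k).ne'
  have hj := (hT j).ne'
  rw [he]
  field_simp
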